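/- Let $\xi$ be Riemann's xi function, i.e. the entire function given by $$\xi(s) = \tfrac12\, s(s-1)\,\pi^{-s/2}\,\Gamma(s/2)\,\zeta(s),$$ where $\Gamma$ is the gamma function, $\zeta$ is the Riemann zeta function, and the removable singularities of the product (at $s=1$ and $s=0,-2,-4,\dots$) are filled in by continuity. (i) Let $\sigma_0\in\mathbb R$ be such that $\xi(s)\neq 0$ for all $s\in\mathbb C$ with $\operatorname{Re} s>\sigma_0$. Then for all real $\sigma_1\ge\sigma_0$ and $t_0$, the function $\sigma\mapsto|\xi(\sigma+it_0)|$ is strictly increasing on $(\sigma_1,\infty)$; that is, $|\xi|$ is strictly increasing in $\sigma$ along every horizontal half-line $\{\sigma+it_0:\sigma>\sigma_1\}$ lying in the open right half-plane $\{\operatorname{Re} s>\sigma_0\}$. (ii) Let $\sigma_0\in\mathbb R$ be such that $\xi(s)\neq 0$ for all $s\in\mathbb C$ with $\operatorname{Re} s<\sigma_0$. Then for all real $\sigma_1\le\sigma_0$ and $t_0$, the function $\sigma\mapsto|\xi(\sigma+it_0)|$ is strictly decreasing on $(-\infty,\sigma_1)$; that is, $|\xi|$ is strictly decreasing in $\sigma$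 along every horizontal half-line $\{\sigma+it_0:\sigma<\sigma_1\}$ lying in the open left half-plane $\{\operatorname{Re} s<\sigma_0\}$. -/

import Mathlib

open Filter Topology

noncomputable section

/-- The product `½ s (s - 1) π^{-s/2} Γ(s/2) ζ(s)`. At its removable singularities `s = 1` and
`s = 0, -2, -4, …` (a pole of `ζ`, the poles of `Γ(s/2)`) the value of this expression is a mere
convention. -/
def xiProduct (s : ℂ) : ℂ :=
  1 / 2 * s * (s - 1) * (Real.pi : ℂ) ^ (-(1 / 2 * s)) * Complex.Gamma (1 / 2 * s) * riemannZeta s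

/-- Riemann's xi function: the entire function given by the product `xiProduct`, its removable
singularities being filled in by taking limits. -/
def riemannXi (s : ℂ) : ℂ :=
  limUnder (𝓝[≠] s) xiProduct

/-- Away from `1` and the poles of `Γ(s/2)`, the product is the restriction of an entire
function. -/
theorem xiProduct_eq {s : ℂ} (h1 : s ≠ 1) (hG : ∀ n : ℕ, s ≠ -(2 * (n : ℂ))) :
    xiProduct s = (s * (s - 1) * completedRiemannZeta₀ s + 1) / 2 := by
  have h0 : s ≠ 0 := by simpa using hG 0
  have h1' : 1 - s ≠ 0 := sub_ne_zero.mpr (Ne.symm h1)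
  have hΓ : Complex.Gammaℝ s ≠ 0 := by
    rw [Ne, Complex.Gammaℝ_eq_zero_iff]
    rintro ⟨n, hn⟩
    exact hG n hn
  have hζ : Complex.Gammaℝ s * riemannZeta s = completedRiemannZeta s := by
    rw [riemannZeta_def_of_ne_zero h0]
    field_simp
  have hx : xiProduct s = s * (s - 1) * (Complex.Gammaℝ s * riemannZeta s) / 2 := by
    rw [xiProduct, Complex.Gammaℝ_def, show -(1 / 2 * s) = -s / 2 by ring,
      show 1 / 2 * s = s / 2 by ring]
    ring
  rw [hx, hζ, completedRiemannZeta_eq]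
  field_simp
  ring

/-- The limit defining `riemannXi` exists at every point. -/
theorem tendsto_xiProduct (s : ℂ) :
    Tendsto xiProduct (𝓝[≠] s) (𝓝 ((s * (s - 1) * completedRiemannZeta₀ s + 1) / 2)) := by
  have hc : Continuous fun w : ℂ => (w * (w - 1) * completedRiemannZeta₀ w + 1) / 2 := by
    have := differentiable_completedZeta₀.continuous
    fun_prop
  refine ((hc.tendsto s).mono_left nhdsWithin_le_nhds).congr' ?_
  have e1 : ∀ᶠ w in 𝓝[≠] s, w ≠ 1 := by
    by_cases h : s = 1
    · subst h
      exact eventually_mem_nhdsWithin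
    · exact nhdsWithin_le_nhds (isOpen_ne.mem_nhds h)
  have e2 : ∀ᶠ w in 𝓝[≠] s, Complex.Gammaℝ⁻¹ w ≠ 0 := by
    have hA : AnalyticOnNhd ℂ (fun w => (Complex.Gammaℝ w)⁻¹) Set.univ :=
      Complex.differentiable_Gammaℝ_inv.differentiableOn.analyticOnNhd isOpen_univ
    rcases (hA s trivial).eventually_eq_zero_or_eventually_ne_zero with h | h
    · have hz := hA.eqOn_zero_of_preconnected_of_eventuallyEq_zero isPreconnected_univ
        trivial h (Set.mem_univ (1 : ℂ))
      simp [Complex.Gammaℝ_one] at hz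
    · exact h
  filter_upwards [e1, e2] with w hw1 hw2
  refine (xiProduct_eq hw1 fun n hn => hw2 ?_).symm
  have : Complex.Gammaℝ w = 0 := Complex.Gammaℝ_eq_zero_iff.mpr ⟨n, hn⟩
  simp [this]

theorem riemannXi_eq (s : ℂ) :
    riemannXi s = (s * (s - 1) * completedRiemannZeta₀ s + 1) / 2 :=
  (tendsto_xiProduct s).limUnder_eq

/-- `riemannXi` is entire. -/
theorem differentiable_riemannXi : Differentiable ℂ riemannXi := by
  have h : riemannXi = fun s => (s * (s - 1) * completedRiemannZeta₀ s + 1) / 2 :=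
    funext riemannXi_eq
  have := differentiable_completedZeta₀
  rw [h]
  fun_prop

/-- `riemannXi` agrees with the product wherever all factors of the product are defined. -/
theorem riemannXi_eq_xiProduct {s : ℂ} (h1 : s ≠ 1) (hG : ∀ n : ℕ, s ≠ -(2 * (n : ℂ))) :
    riemannXi s = xiProduct s := by
  rw [riemannXi_eq, xiProduct_eq h1 hG]

end

/-!
For `σ₀ < a < b` put `c = (a + b) / 2`. The reflection `s ↦ 2c - conj s` in the line `Re s = c`
exchanges `a + it` and `b + it`, so strict monotonicity of `‖riemannXi‖` along horizontal lines says
that `‖riemannXi (2c - conj s)‖ < ‖riemannXi s‖` for `Re s > c`. By the functional equation and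
`riemannXi (conj s) = conj (riemannXi s)`, the left side equals `‖riemannXi (s - (2c - 1))‖`, so the
claim concerns the holomorphic quotient `q s = riemannXi (s - (2c - 1)) / riemannXi s` on the
zero-free half-plane `Re s ≥ c`, which has modulus one on the boundary line. The bound `‖q‖ ≤ 1` is
a Phragmén–Lindelöf statement (`norm_riemannXi_sub_le`), and strictness follows from the maximum
principle (`norm_riemannXi_lt_of_ne_zero`). No product formula over the zeros is needed.

Two growth estimates feed Phragmén–Lindelöf. Far to the right, the product formula for `riemannXi`
together with a Beta integral estimate for quotients of Gamma values bounds `q`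
(`exists_norm_riemannXi_sub_le_mul`). In the remaining vertical strip, exponential growth of `q`
suffices: `riemannXi` is of polynomial growth there, being a Mellin transform up to a quadratic
factor, and a lower bound for it follows from the Borel–Carathéodory inequality on discs of fixed
radius centred far to the right, where the reflection formula bounds the Gamma factor from below
(`exists_exp_le_norm_riemannXi_of_ne_zero`).

The estimate far to the right uses `2c - 1 > 0`, that is, `σ₀ ≥ 1/2`. By the functional equation
this amounts to the existence of a zero (`exists_riemannXi_eq_zero`): without zeros, the same
argument with `c = -1/2` would give `‖riemannXi (s + 2)‖ ≤ ‖riemannXi s‖`, which fails for large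
real `s`. Part (ii) is part (i) transported by the functional equation.
-/

/-! ### Symmetries -/

theorem riemannXi_one_sub (s : ℂ) : riemannXi (1 - s) = riemannXi s := by
  rw [riemannXi_eq, riemannXi_eq, completedRiemannZeta₀_one_sub]
  ring

theorem riemannXi_of_one_lt_re {s : ℂ} (hs : 1 < s.re) : riemannXi s = xiProduct s := by
  refine riemannXi_eq_xiProduct (fun h => ?_) (fun n h => ?_)
  · simp [h] at hs
  · have : s.re = -(2 * (n : ℝ)) := by simp [h]
    have : (0 : ℝ) ≤ n := n.cast_nonneg
    linarith

open ComplexConjugate in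
theorem riemannZeta_conj_of_one_lt_re {s : ℂ} (hs : 1 < s.re) :
    riemannZeta (conj s) = conj (riemannZeta s) := by
  rw [zeta_eq_tsum_one_div_nat_add_one_cpow hs,
    zeta_eq_tsum_one_div_nat_add_one_cpow (by simpa using hs), Complex.conj_tsum]
  refine tsum_congr fun n => ?_
  have harg : ((n : ℂ) + 1).arg ≠ Real.pi := by
    rw [← Nat.cast_succ, Complex.natCast_arg]
    exact Real.pi_ne_zero.symm
  rw [map_div₀, map_one, Complex.cpow_conj _ _ harg]
  simp

open ComplexConjugate in
theorem riemannXi_conj (s : ℂ) : riemannXi (conj s) = conj (riemannXi s) := by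
  have hconj : Differentiable ℂ (conj ∘ riemannXi ∘ conj) := fun z => by
    simpa using (differentiable_riemannXi (conj z)).hasDerivAt.conj_conj.differentiableAt
  have h1 : AnalyticOnNhd ℂ riemannXi Set.univ :=
    differentiable_riemannXi.differentiableOn.analyticOnNhd isOpen_univ
  have h2 : AnalyticOnNhd ℂ (conj ∘ riemannXi ∘ conj) Set.univ :=
    hconj.differentiableOn.analyticOnNhd isOpen_univ
  have h3 : riemannXi =ᶠ[𝓝 2] conj ∘ riemannXi ∘ conj := by
    have : {z : ℂ | 1 < z.re} ∈ 𝓝 (2 : ℂ) :=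
      (isOpen_lt continuous_const Complex.continuous_re).mem_nhds (by simp)
    filter_upwards [this] with z hz
    have hz' : 1 < (conj z).re := by simpa using hz
    have harg : (Real.pi : ℂ).arg ≠ Real.pi := by
      rw [Complex.arg_ofReal_of_nonneg Real.pi_pos.le]
      exact Real.pi_ne_zero.symm
    have hc : (Real.pi : ℂ) ^ (-(1 / 2 * conj z)) = conj ((Real.pi : ℂ) ^ (-(1 / 2 * z))) := by
      rw [← Complex.conj_ofReal, ← Complex.cpow_conj _ _ (by simpa using harg)]
      simp [map_ofNat]
    have hΓ : Complex.Gamma (1 / 2 * conj z) = conj (Complex.Gamma (1 / 2 * z)) := by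
      rw [← Complex.Gamma_conj]
      simp [map_ofNat]
    rw [Function.comp_apply, Function.comp_apply, riemannXi_of_one_lt_re hz,
      riemannXi_of_one_lt_re hz', xiProduct, xiProduct, riemannZeta_conj_of_one_lt_re hz, hc, hΓ]
    simp [map_ofNat]
  have := congrFun (h1.eq_of_eventuallyEq h2 h3) (conj s)
  simpa using this

/-! ### Upper bound in vertical strips -/

/-- A Mellin transform is bounded on every vertical strip where it converges absolutely. -/
theorem exists_norm_mellin_le {f : ℝ → ℂ} (hf : ∀ s, MellinConvergent f s) (a b : ℝ) :
    ∃ C, ∀ s : ℂ, a ≤ s.re → s.re ≤ b → ‖mellin f s‖ ≤ C := by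
  have hn : ∀ s : ℂ, MeasureTheory.IntegrableOn (fun t : ℝ => t ^ (s.re - 1) * ‖f t‖)
      (Set.Ioi 0) := fun s => by
    refine MeasureTheory.IntegrableOn.congr_fun (hf s).norm (fun t ht => ?_) measurableSet_Ioi
    simp [Complex.norm_cpow_eq_rpow_re_of_pos ht]
  refine ⟨∫ t in Set.Ioi (0 : ℝ), (t ^ (a - 1) * ‖f t‖ + t ^ (b - 1) * ‖f t‖), fun s ha hb => ?_⟩
  refine MeasureTheory.norm_integral_le_of_norm_le ?_ ?_
  · have h := (hn a).add (hn b)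
    simp only [Complex.ofReal_re] at h
    exact h
  · refine (MeasureTheory.ae_restrict_iff' measurableSet_Ioi).mpr
      (MeasureTheory.ae_of_all _ fun t ht => ?_)
    have ht0 : (0 : ℝ) < t := ht
    have : ‖((t : ℂ) ^ (s - 1) • f t)‖ = t ^ (s.re - 1) * ‖f t‖ := by
      simp [Complex.norm_cpow_eq_rpow_re_of_pos ht0]
    rw [this, ← add_mul]
    gcongr
    rcases le_total t 1 with h | h
    · have := Real.rpow_le_rpow_of_exponent_ge ht0 h (by linarith : a - 1 ≤ s.re - 1)
      have := Real.rpow_nonneg ht0.le (b - 1)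
      linarith
    · have := Real.rpow_le_rpow_of_exponent_le h (by linarith : s.re - 1 ≤ b - 1)
      have := Real.rpow_nonneg ht0.le (a - 1)
      linarith

theorem exists_norm_completedRiemannZeta₀_le (a b : ℝ) :
    ∃ C, ∀ s : ℂ, a ≤ s.re → s.re ≤ b → ‖completedRiemannZeta₀ s‖ ≤ C := by
  obtain ⟨C, hC⟩ := exists_norm_mellin_le (f := (HurwitzZeta.hurwitzEvenFEPair 0).f_modif)
    (fun s => ((HurwitzZeta.hurwitzEvenFEPair 0).isStrongFEPair_toStrongFEPair.hasMellin s).1)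
    (a / 2) (b / 2)
  refine ⟨C / 2, fun s ha hb => ?_⟩
  have h2 : (s / 2).re = s.re / 2 := by simp
  have : ‖(HurwitzZeta.hurwitzEvenFEPair 0).Λ₀ (s / 2)‖ ≤ C :=
    hC (s / 2) (by rw [h2]; linarith) (by rw [h2]; linarith)
  rw [completedRiemannZeta₀, HurwitzZeta.completedHurwitzZetaEven₀, norm_div, Complex.norm_ofNat]
  gcongr

/-- In a vertical strip, `riemannXi` grows at most exponentially (in fact quadratically). -/
theorem exists_norm_riemannXi_le (a b : ℝ) :
    ∃ A, 0 ≤ A ∧ ∀ s : ℂ, a ≤ s.re → s.re ≤ b → ‖riemannXi s‖ ≤ Real.exp (A * (1 + |s.im|)) := by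
  obtain ⟨C, hC⟩ := exists_norm_completedRiemannZeta₀_le a b
  -- `N` controls `‖s‖` and `‖s - 1‖` by `N * (1 + |s.im|)`
  set N : ℝ := |a| + |b| + 1 with hN
  set D : ℝ := N ^ 2 * (|C| + 1) with hD
  have hN1 : 1 ≤ N := by linarith [abs_nonneg a, abs_nonneg b]
  have hD1 : 1 ≤ D := by
    have : 1 ≤ N ^ 2 := one_le_pow₀ hN1
    nlinarith [abs_nonneg C]
  refine ⟨D + 2, by linarith, fun s ha hb => ?_⟩
  set x : ℝ := 1 + |s.im| with hx
  have hx1 : 1 ≤ x := by linarith [abs_nonneg s.im]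
  have hre : |s.re| ≤ |a| + |b| := by
    rw [abs_le]
    constructor
    · linarith [neg_abs_le a, abs_nonneg b]
    · linarith [le_abs_self b, abs_nonneg a]
  have hs : ‖s‖ ≤ N * x := by
    have := Complex.norm_le_abs_re_add_abs_im s
    nlinarith [abs_nonneg s.im]
  have hs1 : ‖s - 1‖ ≤ N * x := by
    have := Complex.norm_le_abs_re_add_abs_im (s - 1)
    have h1 : |(s - 1).re| ≤ |s.re| + 1 := by simpa using abs_sub s.re 1
    have h2 : (s - 1).im = s.im := by simp
    rw [h2] at this
    nlinarith [abs_nonneg s.im]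
  have hΛ : ‖completedRiemannZeta₀ s‖ ≤ |C| := (hC s ha hb).trans (le_abs_self C)
  have hx2 : x ^ 2 ≤ Real.exp (2 * x) := by
    rw [mul_comm, Real.exp_mul]
    have : x ≤ Real.exp x := by linarith [Real.add_one_le_exp x]
    exact_mod_cast pow_le_pow_left₀ (by linarith) this 2
  have hDx : D ≤ Real.exp (D * x) := by
    have := Real.add_one_le_exp (D * x)
    nlinarith
  calc ‖riemannXi s‖ = ‖s * (s - 1) * completedRiemannZeta₀ s + 1‖ / 2 := by
        rw [riemannXi_eq, norm_div, Complex.norm_ofNat]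
    _ ≤ (‖s‖ * ‖s - 1‖ * ‖completedRiemannZeta₀ s‖ + 1) / 2 := by
        gcongr
        refine (norm_add_le _ _).trans ?_
        simp
    _ ≤ ((N * x) * (N * x) * |C| + 1) / 2 := by gcongr
    _ ≤ D * x ^ 2 := by
        have : 1 ≤ N ^ 2 * x ^ 2 := by
          rw [← mul_pow]
          exact one_le_pow₀ (one_le_mul_of_one_le_of_one_le hN1 hx1)
        have h0 : 0 ≤ N ^ 2 * x ^ 2 * |C| := by positivity
        rw [hD]
        linarith
    _ ≤ Real.exp (D * x) * Real.exp (2 * x) := by gcongr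
    _ = Real.exp ((D + 2) * x) := by rw [← Real.exp_add]; ring_nf

/-! ### Bounds for the factors of `riemannXi` to the right of the critical strip -/

theorem norm_riemannZeta_sub_one_le {s : ℂ} (hs : 2 ≤ s.re) : ‖riemannZeta s - 1‖ ≤ 3 / 4 := by
  have hs1 : 1 < s.re := by linarith
  have hz2 : HasSum (fun n : ℕ => 1 / ((n : ℝ) + 1) ^ 2) (Real.pi ^ 2 / 6) := by
    have := (hasSum_nat_add_iff' 1).mpr hasSum_zeta_two
    simpa using this
  have htail : HasSum (fun n : ℕ => 1 / ((n : ℝ) + 1 + 1) ^ 2) (Real.pi ^ 2 / 6 - 1) := by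
    have := (hasSum_nat_add_iff' 1).mpr hz2
    simpa using this
  have hle : ∀ n : ℕ, ‖1 / ((n : ℂ) + 1 + 1) ^ s‖ ≤ 1 / ((n : ℝ) + 1 + 1) ^ 2 := fun n => by
    have h0 : (0 : ℝ) < (n : ℝ) + 1 + 1 := by positivity
    have h1 : (1 : ℝ) ≤ (n : ℝ) + 1 + 1 := by linarith [(n.cast_nonneg : (0 : ℝ) ≤ n)]
    have hn : ‖((n : ℂ) + 1 + 1) ^ s‖ = ((n : ℝ) + 1 + 1) ^ s.re := by
      rw [← Complex.norm_cpow_eq_rpow_re_of_pos h0]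
      push_cast
      rfl
    rw [norm_div, norm_one, hn]
    gcongr
    exact_mod_cast Real.rpow_le_rpow_of_exponent_le h1 hs
  have hsum : Summable fun n : ℕ => 1 / ((n : ℂ) + 1 + 1) ^ s :=
    Summable.of_norm_bounded htail.summable hle
  have hsum' : Summable fun n : ℕ => 1 / ((n : ℂ) + 1) ^ s :=
    (summable_nat_add_iff 1).mp (by simpa using hsum)
  have hz : riemannZeta s - 1 = ∑' n : ℕ, 1 / ((n : ℂ) + 1 + 1) ^ s := by
    rw [zeta_eq_tsum_one_div_nat_add_one_cpow hs1, hsum'.tsum_eq_zero_add]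
    simp
  rw [hz]
  refine (tsum_of_norm_bounded htail hle).trans ?_
  have := Real.pi_lt_d2
  have := Real.pi_pos
  nlinarith

theorem norm_riemannZeta_le_two {s : ℂ} (hs : 2 ≤ s.re) : ‖riemannZeta s‖ ≤ 2 := by
  have h := norm_riemannZeta_sub_one_le hs
  have := norm_sub_norm_le (riemannZeta s) 1
  rw [norm_one] at this
  linarith

theorem one_div_four_le_norm_riemannZeta {s : ℂ} (hs : 2 ≤ s.re) : 1 / 4 ≤ ‖riemannZeta s‖ := by
  have h := norm_riemannZeta_sub_one_le hs
  have := norm_sub_norm_le 1 (riemannZeta s)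
  rw [norm_one, norm_sub_rev] at this
  linarith

theorem norm_riemannXi_of_one_lt_re {s : ℂ} (hs : 1 < s.re) :
    ‖riemannXi s‖ = 1 / 2 * ‖s‖ * ‖s - 1‖ * Real.pi ^ (-(s.re / 2)) *
      ‖Complex.Gamma (s / 2)‖ * ‖riemannZeta s‖ := by
  rw [riemannXi_of_one_lt_re hs, xiProduct, show 1 / 2 * s = s / 2 by ring]
  have h : (-(s / 2)).re = -(s.re / 2) := by simp
  simp only [norm_mul, norm_div, Complex.norm_ofNat,
    Complex.norm_cpow_eq_rpow_re_of_pos Real.pi_pos, h]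
  ring

/-- The reflection formula gives `|Γ(1/2 + iy)|² = π / cosh (πy)`. -/
theorem exp_le_norm_Gamma_one_half_add (y : ℝ) :
    Real.exp (-(Real.pi * |y|)) ≤ ‖Complex.Gamma (1 / 2 + y * Complex.I)‖ := by
  have h := Complex.Gamma_mul_Gamma_one_sub (1 / 2 + y * Complex.I)
  have hc : (1 : ℂ) - (1 / 2 + y * Complex.I) =
      (starRingEnd ℂ) (1 / 2 + y * Complex.I) := by
    simp [map_ofNat]
    ring
  have hsin : Complex.sin (Real.pi * (1 / 2 + y * Complex.I)) =
      ((Real.cosh (Real.pi * y) : ℝ) : ℂ) := by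
    rw [show (Real.pi : ℂ) * (1 / 2 + y * Complex.I) =
      (Real.pi * y) * Complex.I + Real.pi / 2 by ring, Complex.sin_add_pi_div_two,
      Complex.cos_mul_I]
    push_cast
    rfl
  rw [hc, Complex.Gamma_conj, Complex.mul_conj, hsin] at h
  have h' : ‖Complex.Gamma (1 / 2 + y * Complex.I)‖ ^ 2 = Real.pi / Real.cosh (Real.pi * y) := by
    rw [← Complex.normSq_eq_norm_sq]
    exact_mod_cast h
  have hcosh : Real.cosh (Real.pi * y) ≤ Real.exp (Real.pi * |y|) := by
    rw [← Real.cosh_abs, abs_mul, abs_of_pos Real.pi_pos]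
    linarith [Real.sinh_nonneg_iff.mpr (by positivity : 0 ≤ Real.pi * |y|),
      Real.cosh_add_sinh (Real.pi * |y|)]
  refine le_of_sq_le_sq ?_ (norm_nonneg _)
  rw [h', le_div_iff₀ (Real.cosh_pos _)]
  calc Real.exp (-(Real.pi * |y|)) ^ 2 * Real.cosh (Real.pi * y)
      ≤ Real.exp (-(Real.pi * |y|)) ^ 2 * Real.exp (Real.pi * |y|) := by gcongr
    _ = Real.exp (-(Real.pi * |y|)) := by rw [← Real.exp_nat_mul, ← Real.exp_add]; ring_nf
    _ ≤ 1 := Real.exp_le_one_iff.mpr (by have := Real.pi_pos; simp; positivity)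
    _ ≤ Real.pi := by linarith [Real.pi_gt_three]

theorem exp_le_norm_Gamma_nat_add (m : ℕ) (y : ℝ) :
    (1 / 2) ^ m * Real.exp (-(Real.pi * |y|)) ≤
      ‖Complex.Gamma (m + (1 / 2 + y * Complex.I))‖ := by
  induction m with
  | zero => simpa using exp_le_norm_Gamma_one_half_add y
  | succ m ih =>
    set u : ℂ := m + (1 / 2 + y * Complex.I) with hu
    have hre : u.re = m + 1 / 2 := by simp [hu]
    have hhalf : 1 / 2 ≤ ‖u‖ := by
      have := Complex.re_le_norm u
      have : (0 : ℝ) ≤ m := m.cast_nonneg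
      linarith
    have hu0 : u ≠ 0 := by
      rw [← norm_pos_iff]
      linarith
    have : ((m + 1 : ℕ) : ℂ) + (1 / 2 + y * Complex.I) = u + 1 := by
      push_cast
      ring
    rw [this, Complex.Gamma_add_one u hu0, norm_mul, pow_succ']
    calc 1 / 2 * (1 / 2) ^ m * Real.exp (-(Real.pi * |y|))
        = 1 / 2 * ((1 / 2) ^ m * Real.exp (-(Real.pi * |y|))) := by ring
      _ ≤ ‖u‖ * ‖Complex.Gamma u‖ := by gcongr

/-- Lower bound for `riemannXi` on a vertical line to the right of the critical strip. -/
theorem exists_exp_le_norm_riemannXi (m : ℕ) (hm : 1 ≤ m) :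
    ∃ A, 0 ≤ A ∧ ∀ t : ℝ, Real.exp (-(A * (1 + |t|))) ≤
      ‖riemannXi ((2 * m + 1 : ℝ) + t * Complex.I)‖ := by
  have hm' : (1 : ℝ) ≤ m := by exact_mod_cast hm
  set c : ℝ := 1 / 2 * Real.pi ^ (-((2 * m + 1 : ℝ) / 2)) * (1 / 2) ^ m * (1 / 4) with hcdef
  have hc : 0 < c := by have := Real.pi_pos; positivity
  refine ⟨Real.pi + |Real.log c|, by positivity, fun t => ?_⟩
  set s : ℂ := (2 * m + 1 : ℝ) + t * Complex.I with hs
  have hre : s.re = 2 * m + 1 := by simp [hs]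
  have hs1 : 1 ≤ ‖s‖ := by linarith [Complex.re_le_norm s]
  have hs2 : 1 ≤ ‖s - 1‖ := by
    have := Complex.re_le_norm (s - 1)
    rw [Complex.sub_re, hre, Complex.one_re] at this
    linarith
  have hζ := one_div_four_le_norm_riemannZeta (s := s) (by rw [hre]; linarith)
  have hΓ := exp_le_norm_Gamma_nat_add m (t / 2)
  have hs3 : (m : ℂ) + (1 / 2 + ((t / 2 : ℝ) : ℂ) * Complex.I) = s / 2 := by
    rw [hs]
    push_cast
    ring
  rw [hs3] at hΓ
  have ht : |t / 2| ≤ |t| := by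
    rw [abs_div, abs_two]
    linarith [abs_nonneg t]
  rw [norm_riemannXi_of_one_lt_re (by rw [hre]; linarith), hre]
  calc Real.exp (-((Real.pi + |Real.log c|) * (1 + |t|)))
      ≤ Real.exp (Real.log c + -(Real.pi * |t / 2|)) := by
        apply Real.exp_le_exp.mpr
        have h1 := neg_abs_le (Real.log c)
        have h2 : 0 ≤ |Real.log c| * |t| := by positivity
        have h3 : Real.pi * |t / 2| ≤ Real.pi * |t| :=
          mul_le_mul_of_nonneg_left ht Real.pi_pos.le
        have := Real.pi_pos
        linarith
    _ = 1 / 2 * 1 * 1 * Real.pi ^ (-((2 * m + 1 : ℝ) / 2)) *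
        ((1 / 2) ^ m * Real.exp (-(Real.pi * |t / 2|))) * (1 / 4) := by
        rw [Real.exp_add, Real.exp_log hc, hcdef]
        ring
    _ ≤ _ := by
        have := Real.pi_pos
        gcongr

/-! ### Lower bound for zero-free functions -/

/-- The Borel–Carathéodory inequality for a branch of `log f`: an upper bound for a zero-free
function on a disc and a lower bound at the centre give a lower bound on smaller discs. -/
theorem exp_le_norm_of_forall_ball_ne_zero {f : ℂ → ℂ} {R r M : ℝ} (hM : 0 < M) (hR : 0 < R)
    (hr : r < R) (hf : DifferentiableOn ℂ f (Metric.ball 0 R))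
    (hf0 : ∀ w ∈ Metric.ball (0 : ℂ) R, f w ≠ 0)
    (hub : ∀ w ∈ Metric.ball (0 : ℂ) R, ‖f w‖ ≤ Real.exp M) (hlb : Real.exp (-M) ≤ ‖f 0‖)
    {w : ℂ} (hw : ‖w‖ ≤ r) : Real.exp (-(M + 4 * M * r / (R - r))) ≤ ‖f w‖ := by
  have h0 : (0 : ℂ) ∈ Metric.ball (0 : ℂ) R := Metric.mem_ball_self hR
  have hwR : w ∈ Metric.ball (0 : ℂ) R := by
    rw [mem_ball_zero_iff]
    linarith
  obtain ⟨g, hg0, hg⟩ := ((hf.deriv Metric.isOpen_ball).div hf hf0).isExactOn_ball.with_val_at 0 0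
  have hfat : ∀ z ∈ Metric.ball (0 : ℂ) R, DifferentiableAt ℂ f z := fun z hz =>
    hf.differentiableAt (Metric.isOpen_ball.mem_nhds hz)
  have hexp : ∀ z ∈ Metric.ball (0 : ℂ) R, f z = f 0 * Complex.exp (g z) := by
    -- `g` is a primitive of `f' / f`, so `f * exp (-g)` is constant
    have hd : ∀ z ∈ Metric.ball (0 : ℂ) R,
        HasDerivAt (fun z => f z * Complex.exp (-g z)) 0 z := fun z hz => by
      refine ((hfat z hz).hasDerivAt.mul (hg z hz).neg.cexp).congr_deriv ?_
      have := hf0 z hz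
      simp only [Pi.div_apply, Pi.neg_apply]
      field_simp
      ring
    intro z hz
    have hconst := (convex_ball (0 : ℂ) R).is_const_of_fderivWithin_eq_zero (𝕜 := ℂ)
      (f := fun z => f z * Complex.exp (-g z))
      (fun x hx => (hd x hx).differentiableAt.differentiableWithinAt)
      (fun x hx => by
        rw [fderivWithin_of_isOpen Metric.isOpen_ball hx]
        ext
        simp [(hd x hx).deriv]) hz h0
    simp only [hg0, neg_zero, Complex.exp_zero, mul_one] at hconst
    rw [← hconst, mul_assoc, ← Complex.exp_add]
    simp
  have hre : Set.MapsTo g (Metric.ball 0 R) {z | z.re ≤ 2 * M} := fun z hz => by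
    have h1 := hub z hz
    rw [hexp z hz, norm_mul, Complex.norm_exp] at h1
    have h2 : Real.exp (-M) * Real.exp (g z).re ≤ Real.exp M :=
      (mul_le_mul_of_nonneg_right hlb (Real.exp_pos _).le).trans h1
    rw [← Real.exp_add, Real.exp_le_exp] at h2
    simp only [Set.mem_ofPred_eq]
    linarith
  have hBC := Complex.borelCaratheodory_zero (by linarith : 0 < 2 * M)
    (fun z hz => (hg z hz).differentiableAt.differentiableWithinAt) hre hR hwR hg0
  have hle : ‖g w‖ ≤ 4 * M * r / (R - r) := by
    refine hBC.trans ?_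
    have : 0 < R - r := by linarith
    have : 0 ≤ r := (norm_nonneg w).trans hw
    rw [show 4 * M * r = 2 * (2 * M) * r by ring]
    gcongr
  rw [hexp w hwR, norm_mul, Complex.norm_exp, neg_add, Real.exp_add]
  gcongr
  have := (abs_le.mp (Complex.abs_re_le_norm (g w))).1
  linarith

/-- In a closed substrip of a zero-free half-plane, `1 / riemannXi` grows at most exponentially. -/
theorem exists_exp_le_norm_riemannXi_of_ne_zero {σ₀ c K : ℝ}
    (h0 : ∀ s : ℂ, σ₀ < s.re → riemannXi s ≠ 0) (hc : σ₀ < c) :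
    ∃ A, 0 ≤ A ∧ ∀ s : ℂ, c ≤ s.re → s.re ≤ K →
      Real.exp (-(A * (1 + |s.im|))) ≤ ‖riemannXi s‖ := by
  -- the discs are centred on the line `Re s = k`, beyond the strip; the disc of radius `R` just
  -- fits into the zero-free half-plane, and the one of radius `r` reaches the line `Re s = c`
  obtain ⟨m, hm⟩ := exists_nat_gt (max 1 (max K c))
  have hm1 : (1 : ℝ) < m := (le_max_left _ _).trans_lt hm
  have hmK : K < m := ((le_max_left _ _).trans (le_max_right _ _)).trans_lt hm
  have hmc : c < m := ((le_max_right _ _).trans (le_max_right _ _)).trans_lt hm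
  set k : ℝ := 2 * m + 1 with hk
  set R : ℝ := k - σ₀ with hR
  set r : ℝ := k - c with hr
  have hrR : r < R := by linarith
  have hr0 : 0 < r := by linarith
  obtain ⟨A₁, hA₁, hlow⟩ := exists_exp_le_norm_riemannXi m (by exact_mod_cast hm1.le)
  obtain ⟨A₂, hA₂, hup⟩ := exists_norm_riemannXi_le (k - R) (k + R)
  set B : ℝ := A₁ + A₂ * (1 + R) + 1 with hB
  have hAR : 0 ≤ A₂ * (1 + R) := by
    have : 0 < R := by linarith
    positivity
  refine ⟨B + 4 * B * r / (R - r), ?_, fun s hcs hsK => ?_⟩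
  · have : 0 < R - r := by linarith
    positivity
  set x : ℝ := 1 + |s.im| with hx
  have hx1 : 1 ≤ x := by linarith [abs_nonneg s.im]
  set z₀ : ℂ := (k : ℝ) + s.im * Complex.I with hz₀
  have key := exp_le_norm_of_forall_ball_ne_zero (f := fun w => riemannXi (z₀ + w)) (R := R)
    (r := r) (M := B * x) (by positivity) (by linarith) hrR
    ((differentiable_riemannXi.comp (differentiable_id.const_add z₀)).differentiableOn)
    (fun w hw => h0 _ ?_) (fun w hw => ?_) ?_ (w := s - z₀) ?_
  · rw [show z₀ + (s - z₀) = s by ring] at key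
    refine le_trans (Real.exp_le_exp.mpr (le_of_eq ?_)) key
    ring
  · have h1 := (abs_le.mp (Complex.abs_re_le_norm w)).1
    rw [mem_ball_zero_iff] at hw
    simp [hz₀]
    linarith
  · rw [mem_ball_zero_iff] at hw
    have h1 := abs_le.mp (Complex.abs_re_le_norm w)
    have h2 := Complex.abs_im_le_norm w
    have h3 : |(z₀ + w).im| ≤ |s.im| + R := by
      have : (z₀ + w).im = s.im + w.im := by simp [hz₀]
      rw [this]
      linarith [abs_add_le s.im w.im]
    have hre : (z₀ + w).re = k + w.re := by simp [hz₀]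
    refine (hup (z₀ + w) (by rw [hre]; linarith) (by rw [hre]; linarith)).trans
      (Real.exp_le_exp.mpr ?_)
    have h4 : A₂ * (1 + |(z₀ + w).im|) ≤ A₂ * ((1 + R) * x) := by
      gcongr
      have : 0 ≤ R * |s.im| := by
        have : 0 < R := by linarith
        positivity
      rw [hx]
      linarith
    nlinarith
  · have h1 := hlow s.im
    rw [add_zero]
    refine le_trans (Real.exp_le_exp.mpr ?_) h1
    nlinarith
  · have : s - z₀ = ((s.re - k : ℝ) : ℂ) := by
      apply Complex.ext <;> simp [hz₀]
    rw [this, Complex.norm_real, Real.norm_eq_abs, abs_le]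
    constructor <;> linarith

/-! ### Comparison of `riemannXi` with its horizontal translates -/

/-- The Beta integral `Γ(u)Γ(a)/Γ(u+a) = ∫₀¹ t^(u-1) (1-t)^(a-1) dt` has modulus at most `1/a`. -/
theorem Gamma_add_one_mul_norm_Gamma_le {a : ℝ} (ha : 0 < a) {u : ℂ} (hu : 1 ≤ u.re) :
    Real.Gamma (a + 1) * ‖Complex.Gamma u‖ ≤ ‖Complex.Gamma (u + a)‖ := by
  have hB : ‖Complex.betaIntegral u a‖ ≤ 1 / a := by
    have hint : ∫ t : ℝ in (0 : ℝ)..1, (1 - t) ^ (a - 1) = 1 / a := by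
      rw [intervalIntegral.integral_comp_sub_left (fun t : ℝ => t ^ (a - 1)) 1,
        integral_rpow (Or.inl (by linarith))]
      simp [ha.ne']
    rw [← hint]
    refine intervalIntegral.norm_integral_le_of_norm_le zero_le_one ?_ ?_
    · refine MeasureTheory.ae_of_all _ fun t ht => ?_
      obtain ⟨h0, h1⟩ := ht
      rcases h1.lt_or_eq with h1 | h1
      · have h2 : (1 : ℂ) - t = ((1 - t : ℝ) : ℂ) := by push_cast; rfl
        rw [norm_mul, h2, Complex.norm_cpow_eq_rpow_re_of_pos h0,
          Complex.norm_cpow_eq_rpow_re_of_pos (by linarith)]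
        have h3 : t ^ (u - 1).re ≤ 1 :=
          Real.rpow_le_one h0.le h1.le (by simpa using hu)
        have h4 : ((a : ℂ) - 1).re = a - 1 := by simp
        rw [h4]
        exact mul_le_of_le_one_left (Real.rpow_nonneg (by linarith) _) h3
      · subst h1
        rcases eq_or_ne a 1 with rfl | h
        · simp
        · have h' : (a : ℂ) - 1 ≠ 0 := by
            rw [sub_ne_zero]
            exact_mod_cast h
          simp [Complex.zero_cpow h', Real.zero_rpow (sub_ne_zero.mpr h)]
    · have := (intervalIntegral.intervalIntegrable_rpow' (a := 1) (b := 0)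
        (by linarith : -1 < a - 1)).comp_sub_left 1
      simpa using this
  have h := Complex.Gamma_mul_Gamma_eq_betaIntegral (s := u) (t := a) (by linarith) (by simpa)
  rw [Complex.Gamma_ofReal] at h
  have h' := congrArg norm h
  rw [norm_mul, norm_mul, Complex.norm_real, Real.norm_eq_abs,
    abs_of_pos (Real.Gamma_pos_of_pos ha)] at h'
  rw [Real.Gamma_add_one ha.ne']
  calc a * Real.Gamma a * ‖Complex.Gamma u‖ = a * (‖Complex.Gamma u‖ * Real.Gamma a) := by ring
    _ = a * (‖Complex.Gamma (u + a)‖ * ‖Complex.betaIntegral u a‖) := by rw [h']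
    _ ≤ a * (‖Complex.Gamma (u + a)‖ * (1 / a)) := by gcongr
    _ = ‖Complex.Gamma (u + a)‖ := by field_simp

theorem norm_sub_ofReal_le {d : ℝ} (hd : 0 ≤ d) {s : ℂ} (hs : d ≤ s.re) : ‖s - d‖ ≤ ‖s‖ := by
  refine (sq_le_sq₀ (norm_nonneg _) (norm_nonneg _)).mp ?_
  rw [← Complex.normSq_eq_norm_sq, ← Complex.normSq_eq_norm_sq, Complex.normSq_apply,
    Complex.normSq_apply]
  simp
  nlinarith

/-- To the right of `Re s = d + 2` both arguments lie in `Re ≥ 2`, where all factors of the product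
formula are comparable. -/
theorem exists_norm_riemannXi_sub_le_mul {d : ℝ} (hd : 0 < d) :
    ∃ M, 0 ≤ M ∧ ∀ s : ℂ, d + 2 ≤ s.re → ‖riemannXi (s - d)‖ ≤ M * ‖riemannXi s‖ := by
  have hπ := Real.pi_pos
  have hΓ0 : 0 < Real.Gamma (d / 2 + 1) := Real.Gamma_pos_of_pos (by linarith)
  refine ⟨8 * Real.pi ^ (d / 2) / Real.Gamma (d / 2 + 1), by positivity, fun s hs => ?_⟩
  have hre : (s - d).re = s.re - d := by simp
  have hΓ := Gamma_add_one_mul_norm_Gamma_le (a := d / 2) (by linarith) (u := (s - d) / 2)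
    (by simp; linarith)
  rw [show (s - d) / 2 + ((d / 2 : ℝ) : ℂ) = s / 2 by push_cast; ring] at hΓ
  have hΓ' : ‖Complex.Gamma ((s - d) / 2)‖ ≤
      ‖Complex.Gamma (s / 2)‖ / Real.Gamma (d / 2 + 1) := by
    rw [le_div_iff₀ hΓ0]
    linarith
  have h1 : ‖s - d‖ ≤ ‖s‖ := norm_sub_ofReal_le hd.le (by linarith)
  have h2 : ‖s - d - 1‖ ≤ ‖s - 1‖ := by
    rw [sub_right_comm]
    exact norm_sub_ofReal_le hd.le (by simp; linarith)
  have h3 : ‖riemannZeta (s - d)‖ ≤ 8 * ‖riemannZeta s‖ := by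
    linarith [norm_riemannZeta_le_two (s := s - d) (by rw [hre]; linarith),
      one_div_four_le_norm_riemannZeta (s := s) (by linarith)]
  rw [norm_riemannXi_of_one_lt_re (s := s - d) (by rw [hre]; linarith),
    norm_riemannXi_of_one_lt_re (s := s) (by linarith), hre,
    show -((s.re - d) / 2) = -(s.re / 2) + d / 2 by ring, Real.rpow_add hπ]
  calc _ ≤ 1 / 2 * ‖s‖ * ‖s - 1‖ * (Real.pi ^ (-(s.re / 2)) * Real.pi ^ (d / 2)) *
        (‖Complex.Gamma (s / 2)‖ / Real.Gamma (d / 2 + 1)) * (8 * ‖riemannZeta s‖) := by gcongr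
    _ = _ := by ring

/-- For the shift by `2` the quotient of Gamma values is exactly `s / 2`. -/
theorem norm_riemannXi_add_two {s : ℂ} (hs : 1 < s.re) :
    ‖riemannXi (s + 2)‖ = 1 / (4 * Real.pi) * ‖s + 2‖ * ‖s + 1‖ * ‖s‖ * Real.pi ^ (-(s.re / 2)) *
      ‖Complex.Gamma (s / 2)‖ * ‖riemannZeta (s + 2)‖ := by
  have hs0 : s / 2 ≠ 0 := by
    intro h
    have : (s / 2).re = 0 := by rw [h]; rfl
    simp at this
    linarith
  have hre : (s + 2).re = s.re + 2 := by simp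
  rw [norm_riemannXi_of_one_lt_re (s := s + 2) (by rw [hre]; linarith), hre,
    show s + 2 - 1 = s + 1 by ring, show (s + 2) / 2 = s / 2 + 1 by ring,
    Complex.Gamma_add_one _ hs0, norm_mul, norm_div, Complex.norm_ofNat,
    show -((s.re + 2) / 2) = -(s.re / 2) + -1 by ring, Real.rpow_add Real.pi_pos,
    Real.rpow_neg_one]
  ring

theorem norm_riemannXi_add_two_le {s : ℂ} (hs : 2 ≤ s.re) :
    ‖riemannXi (s + 2)‖ ≤ 48 * ‖s‖ * ‖riemannXi s‖ := by
  rw [norm_riemannXi_add_two (by linarith), norm_riemannXi_of_one_lt_re (s := s) (by linarith)]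
  have h1 : ‖s + 2‖ ≤ 2 * ‖s‖ := by
    have := norm_add_le s 2
    rw [Complex.norm_ofNat] at this
    linarith [Complex.re_le_norm s]
  have h2 : ‖s + 1‖ ≤ 3 * ‖s - 1‖ := by
    have := norm_add_le (s - 1) 2
    rw [Complex.norm_ofNat, show s - 1 + 2 = s + 1 by ring] at this
    have h := Complex.re_le_norm (s - 1)
    rw [Complex.sub_re, Complex.one_re] at h
    linarith
  have h3 : ‖riemannZeta (s + 2)‖ ≤ 8 * ‖riemannZeta s‖ := by
    linarith [norm_riemannZeta_le_two (s := s + 2) (by simp; linarith),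
      one_div_four_le_norm_riemannZeta (s := s) (by linarith)]
  have h4 : 1 / (4 * Real.pi) ≤ 1 / 2 :=
    one_div_le_one_div_of_le two_pos (by linarith [Real.pi_gt_three])
  have hπ := Real.pi_pos
  calc _ ≤ 1 / 2 * (2 * ‖s‖) * (3 * ‖s - 1‖) * ‖s‖ * Real.pi ^ (-(s.re / 2)) *
      ‖Complex.Gamma (s / 2)‖ * (8 * ‖riemannZeta s‖) := by gcongr
    _ = _ := by ring

/-- For real `x` the quotient of consecutive values is about `x / (2π)`, up to zeta values between
`1 / 4` and `2`. -/
theorem norm_riemannXi_lt_add_two {x : ℝ} (hx : 100 ≤ x) :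
    ‖riemannXi x‖ < ‖riemannXi (x + 2)‖ := by
  have hre : ((x : ℂ)).re = x := Complex.ofReal_re x
  have hx0 : (0 : ℝ) ≤ x := by linarith
  rw [norm_riemannXi_add_two (by rw [hre]; linarith),
    norm_riemannXi_of_one_lt_re (by rw [hre]; linarith), hre]
  have e0 : ‖(x : ℂ)‖ = x := by rw [Complex.norm_real, Real.norm_of_nonneg hx0]
  have e1 : ‖(x : ℂ) - 1‖ = x - 1 := by
    rw [← Complex.ofReal_one, ← Complex.ofReal_sub, Complex.norm_real,
      Real.norm_of_nonneg (by linarith)]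
  have e2 : ‖(x : ℂ) + 1‖ = x + 1 := by
    rw [← Complex.ofReal_one, ← Complex.ofReal_add, Complex.norm_real,
      Real.norm_of_nonneg (by linarith)]
  have e3 : ‖(x : ℂ) + 2‖ = x + 2 := by
    rw [← Complex.ofReal_ofNat, ← Complex.ofReal_add, Complex.norm_real,
      Real.norm_of_nonneg (by linarith)]
  rw [e0, e1, e2, e3]
  have hπ := Real.pi_pos
  have hG : 0 < Real.pi ^ (-(x / 2)) * ‖Complex.Gamma ((x : ℂ) / 2)‖ := by
    refine mul_pos (by positivity) (norm_pos_iff.mpr (Complex.Gamma_ne_zero_of_re_pos ?_))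
    simp
    linarith
  set G : ℝ := Real.pi ^ (-(x / 2)) * ‖Complex.Gamma ((x : ℂ) / 2)‖
  have h1 : ‖riemannZeta x‖ ≤ 2 := norm_riemannZeta_le_two (by rw [hre]; linarith)
  have h2 : 1 / 4 ≤ ‖riemannZeta (x + 2)‖ :=
    one_div_four_le_norm_riemannZeta (by simp; linarith)
  have h3 : 1 / 16 ≤ 1 / (4 * Real.pi) :=
    one_div_le_one_div_of_le (by linarith) (by linarith [Real.pi_lt_four])
  calc _ = 1 / 2 * x * (x - 1) * G * ‖riemannZeta x‖ := by ring
    _ ≤ 1 / 2 * x * (x - 1) * G * 2 := by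
        have : 0 ≤ x - 1 := by linarith
        gcongr
    _ < 1 / 16 * (x + 2) * (x + 1) * x * G * (1 / 4) := by
        have : 0 < x * G := by positivity
        nlinarith [mul_pos this (by nlinarith : 0 < 1 / 64 * (x + 2) * (x + 1) - (x - 1))]
    _ ≤ 1 / (4 * Real.pi) * (x + 2) * (x + 1) * x * G * ‖riemannZeta (x + 2)‖ := by gcongr
    _ = _ := by ring

/-! ### The Phragmén–Lindelöf argument -/

theorem diffContOnCl_of_differentiableAt {f : ℂ → ℂ} {c : ℝ} {S : Set ℂ}
    (hS : S ⊆ {s | c ≤ s.re}) (hf : ∀ s : ℂ, c ≤ s.re → DifferentiableAt ℂ f s) :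
    DiffContOnCl ℂ f S := by
  have hcl : closure S ⊆ {s | c ≤ s.re} :=
    closure_minimal hS (isClosed_le continuous_const Complex.continuous_re)
  exact ⟨fun s hs => (hf s (hS hs)).differentiableWithinAt,
    fun s hs => (hf s (hcl hs)).continuousAt.continuousWithinAt⟩

open ComplexConjugate in
/-- The translate `s ↦ s - (2c - 1)` and the reflection in the line `Re s = c` have the same effect
on `‖riemannXi‖`. -/
theorem norm_riemannXi_sub (c : ℝ) (s : ℂ) :
    ‖riemannXi (s - (2 * c - 1 : ℝ))‖ = ‖riemannXi (2 * c - conj s)‖ := by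
  rw [← riemannXi_one_sub, ← RCLike.norm_conj, ← riemannXi_conj]
  congr 2
  simp [map_ofNat]
  ring

theorem norm_riemannXi_sub_of_re_eq {c : ℝ} {s : ℂ} (hs : s.re = c) :
    ‖riemannXi (s - (2 * c - 1 : ℝ))‖ = ‖riemannXi s‖ := by
  rw [norm_riemannXi_sub]
  congr 2
  apply Complex.ext
  · simp [hs]
    ring
  · simp

/-- Phragmén–Lindelöf in the strip `c ≤ Re s ≤ K`: the quotient
`riemannXi (s - (2c - 1)) / riemannXi s` has modulus one on the left edge and grows at most
exponentially in the strip, so a linear bound to the right of the strip extends to the strip. -/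
theorem exists_norm_riemannXi_sub_le {σ₀ c K M : ℝ} (h0 : ∀ s : ℂ, σ₀ < s.re → riemannXi s ≠ 0)
    (hc : σ₀ < c) (hM : ∀ s : ℂ, K ≤ s.re →
      ‖riemannXi (s - (2 * c - 1 : ℝ))‖ ≤ M * ‖s - c + 1‖ * ‖riemannXi s‖) :
    ∃ M', 0 ≤ M' ∧ ∀ s : ℂ, c ≤ s.re →
      ‖riemannXi (s - (2 * c - 1 : ℝ))‖ ≤ M' * ‖s - c + 1‖ * ‖riemannXi s‖ := by
  set b : ℝ := max K (c + 1) with hb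
  have hcb : c < b := (by linarith : c < c + 1).trans_le (le_max_right _ _)
  have hKb : K ≤ b := le_max_left _ _
  have hn1 : ∀ s : ℂ, c ≤ s.re → 1 ≤ ‖s - c + 1‖ := fun s hs => by
    have := Complex.re_le_norm (s - c + 1)
    simp at this
    linarith
  refine ⟨max M 1, le_max_of_le_right zero_le_one, fun s hs => ?_⟩
  rcases le_total b s.re with hsb | hsb
  · refine (hM s (hKb.trans hsb)).trans ?_
    gcongr
    exact le_max_left _ _
  set F : ℂ → ℂ := fun s => riemannXi (s - (2 * c - 1 : ℝ)) / (riemannXi s * (s - c + 1)) with hF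
  have hξ : ∀ s : ℂ, c ≤ s.re → 0 < ‖riemannXi s‖ := fun s hs =>
    norm_pos_iff.mpr (h0 s (hc.trans_le hs))
  have hnF : ∀ s, ‖F s‖ = ‖riemannXi (s - (2 * c - 1 : ℝ))‖ / (‖riemannXi s‖ * ‖s - c + 1‖) :=
    fun s => by rw [hF]; simp only [norm_div, norm_mul]
  have hFd : ∀ s : ℂ, c ≤ s.re → DifferentiableAt ℂ F s := fun s hs => by
    have h1 : s - c + 1 ≠ 0 := by
      rw [← norm_pos_iff]
      linarith [hn1 s hs]
    refine DifferentiableAt.div ?_ ?_ (mul_ne_zero (h0 s (hc.trans_le hs)) h1)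
    · exact (differentiable_riemannXi _).comp s (differentiableAt_id.sub_const _)
    · exact (differentiable_riemannXi s).mul ((differentiableAt_id.sub_const _).add_const _)
  obtain ⟨A₁, hA₁, hlow⟩ := exists_exp_le_norm_riemannXi_of_ne_zero (K := b) h0 hc
  obtain ⟨A₂, hA₂, hup⟩ := exists_norm_riemannXi_le (c - (2 * c - 1)) (b - (2 * c - 1))
  have hgrowth : ∀ z : ℂ, c ≤ z.re → z.re ≤ b → ‖F z‖ ≤ Real.exp ((A₂ + A₁) * (1 + |z.im|)) :=
    fun z hz1 hz2 => by
      have h1 := hlow z hz1 hz2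
      have h2 := hup (z - (2 * c - 1 : ℝ)) (by simpa using hz1) (by simpa using hz2)
      have him : (z - (2 * c - 1 : ℝ)).im = z.im := by
        rw [Complex.sub_im, Complex.ofReal_im, sub_zero]
      rw [him] at h2
      rw [hnF, add_mul, Real.exp_add, div_le_iff₀ (mul_pos (hξ z hz1) (by linarith [hn1 z hz1]))]
      have h3 : 1 ≤ Real.exp (A₁ * (1 + |z.im|)) * ‖riemannXi z‖ := by
        rw [Real.exp_neg] at h1
        rwa [← inv_le_iff_one_le_mul₀' (Real.exp_pos _)]
      have h4 : 1 ≤ Real.exp (A₁ * (1 + |z.im|)) * ‖riemannXi z‖ * ‖z - c + 1‖ :=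
        one_le_mul_of_one_le_of_one_le h3 (hn1 z hz1)
      calc _ ≤ Real.exp (A₂ * (1 + |z.im|)) * 1 := by rw [mul_one]; exact h2
        _ ≤ Real.exp (A₂ * (1 + |z.im|)) *
          (Real.exp (A₁ * (1 + |z.im|)) * ‖riemannXi z‖ * ‖z - c + 1‖) := by gcongr
        _ = _ := by ring
  have key : ‖F s‖ ≤ max M 1 := by
    refine PhragmenLindelof.vertical_strip (a := c) (b := b)
      (diffContOnCl_of_differentiableAt (fun z hz => hz.1.le) hFd) ?_ ?_ ?_ hs hsb
    · set κ : ℝ := Real.pi / (b - c) / 2 with hκ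
      have hκ0 : 0 < κ := by
        have := Real.pi_pos
        have : 0 < b - c := by linarith
        positivity
      refine ⟨κ, by linarith, (A₂ + A₁) * (1 + 1 / κ), ?_⟩
      refine Asymptotics.IsBigO.of_bound 1 (Filter.mem_inf_of_right fun z hz => ?_)
      simp only [Set.mem_ofPred_eq, one_mul, Real.norm_eq_abs, Real.abs_exp]
      refine (hgrowth z hz.1.le hz.2.le).trans (Real.exp_le_exp.mpr ?_)
      rw [mul_assoc]
      gcongr
      have h1 : 1 ≤ Real.exp (κ * |z.im|) := Real.one_le_exp (by positivity)
      have h2 : |z.im| ≤ 1 / κ * Real.exp (κ * |z.im|) := by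
        rw [one_div, ← div_eq_inv_mul, le_div_iff₀ hκ0]
        linarith [Real.add_one_le_exp (κ * |z.im|)]
      linarith
    · intro z hz
      rw [hnF, norm_riemannXi_sub_of_re_eq hz]
      have h1 := hn1 z hz.ge
      have h2 := hξ z hz.ge
      refine le_max_of_le_right (div_le_one_of_le₀ ?_ (by positivity))
      exact le_mul_of_one_le_right h2.le h1
    · intro z hz
      rw [hnF]
      have h1 := hn1 z (by linarith)
      have h2 := hξ z (by linarith)
      refine le_max_of_le_left ?_
      rw [div_le_iff₀ (mul_pos h2 (by linarith))]
      have := hM z (by linarith)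
      linarith
  rw [hnF, div_le_iff₀ (mul_pos (hξ s hs) (by linarith [hn1 s hs]))] at key
  linarith

/-- Phragmén–Lindelöf in the half-plane `Re s ≥ c`: the quotient
`riemannXi (s - (2c - 1)) / riemannXi s` has modulus one on the boundary, hence modulus at most one
inside as soon as it grows at most linearly far to the right. -/
theorem norm_riemannXi_sub_le {σ₀ c K M : ℝ} (h0 : ∀ s : ℂ, σ₀ < s.re → riemannXi s ≠ 0)
    (hc : σ₀ < c) (hM : ∀ s : ℂ, K ≤ s.re →
      ‖riemannXi (s - (2 * c - 1 : ℝ))‖ ≤ M * ‖s - c + 1‖ * ‖riemannXi s‖)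
    {s : ℂ} (hs : c ≤ s.re) : ‖riemannXi (s - (2 * c - 1 : ℝ))‖ ≤ ‖riemannXi s‖ := by
  obtain ⟨N, hN, hlin⟩ := exists_norm_riemannXi_sub_le h0 hc hM
  have hξ : ∀ s : ℂ, c ≤ s.re → 0 < ‖riemannXi s‖ := fun s hs =>
    norm_pos_iff.mpr (h0 s (hc.trans_le hs))
  set q : ℂ → ℂ := fun z => riemannXi (c + z - (2 * c - 1 : ℝ)) / riemannXi (c + z) with hq
  have hre : ∀ z : ℂ, 0 ≤ z.re → c ≤ ((c : ℂ) + z).re := fun z hz => by simpa using hz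
  have hqlin : ∀ z : ℂ, 0 ≤ z.re → ‖q z‖ ≤ N * ‖z + 1‖ := fun z hz => by
    have h := hlin (c + z) (hre z hz)
    rw [hq]
    simp only [norm_div]
    rw [div_le_iff₀ (hξ _ (hre z hz))]
    rwa [show (c : ℂ) + z - c + 1 = z + 1 by ring] at h
  have hqd : ∀ z : ℂ, 0 ≤ z.re → DifferentiableAt ℂ q z := fun z hz => by
    refine DifferentiableAt.div ?_ ?_ (h0 _ (hc.trans_le (hre z hz)))
    · exact (differentiable_riemannXi _).comp z ((differentiableAt_id.const_add _).sub_const _)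
    · exact (differentiable_riemannXi _).comp z (differentiableAt_id.const_add _)
  have hqb : ∀ x : ℝ, ‖q (x * Complex.I)‖ = 1 := fun x => by
    rw [hq]
    simp only [norm_div]
    rw [norm_riemannXi_sub_of_re_eq (by simp), div_self (hξ _ (by simp)).ne']
  -- the factor `exp (-ε z)` turns linear growth on the real axis into decay
  have hε : ∀ ε : ℝ, 0 < ε → ∀ z : ℂ, 0 ≤ z.re → ‖q z‖ ≤ Real.exp (ε * z.re) := by
    intro ε hε z hz
    set G : ℂ → ℂ := fun z => q z * Complex.exp (-(ε * z)) with hG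
    have hnG : ∀ z, ‖G z‖ = ‖q z‖ * Real.exp (-(ε * z.re)) := fun z => by
      rw [hG]
      simp [Complex.norm_exp]
    have key : ‖G z‖ ≤ 1 := by
      refine PhragmenLindelof.right_half_plane_of_tendsto_zero_on_real
        (diffContOnCl_of_differentiableAt (c := 0) (fun z (hz : 0 < z.re) => hz.le) ?_) ?_ ?_ ?_ hz
      · intro z hz
        exact (hqd z hz).mul (by fun_prop)
      · refine ⟨1, one_lt_two, 1, Asymptotics.IsBigO.of_bound N
          (Filter.mem_inf_of_right fun z hz => ?_)⟩
        have hz0 : 0 < z.re := hz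
        simp only [Set.mem_ofPred_eq, one_mul, Real.norm_eq_abs, Real.abs_exp, Real.rpow_one]
        have h1 : ‖z + 1‖ ≤ Real.exp ‖z‖ := by
          have := norm_add_le z 1
          rw [norm_one] at this
          linarith [Real.add_one_le_exp ‖z‖]
        have h2 : Real.exp (-(ε * z.re)) ≤ 1 :=
          Real.exp_le_one_iff.mpr (by simp only [Left.neg_nonpos_iff]; positivity)
        calc ‖G z‖ = ‖q z‖ * Real.exp (-(ε * z.re)) := hnG z
          _ ≤ ‖q z‖ * 1 := by gcongr
          _ ≤ N * ‖z + 1‖ := by rw [mul_one]; exact hqlin z hz0.le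
          _ ≤ N * Real.exp ‖z‖ := by gcongr
      · rw [tendsto_zero_iff_norm_tendsto_zero]
        have hlim := (tendsto_rpow_mul_exp_neg_mul_atTop_nhds_zero 1 ε hε).const_mul (2 * N)
        rw [mul_zero] at hlim
        refine squeeze_zero' (Eventually.of_forall fun x => norm_nonneg _) ?_ hlim
        filter_upwards [eventually_ge_atTop 1] with x hx
        have h1 : ‖(x : ℂ) + 1‖ = x + 1 := by
          rw [← Complex.ofReal_one, ← Complex.ofReal_add, Complex.norm_real,
            Real.norm_of_nonneg (by linarith)]
        have h2 := hqlin x (by simp; linarith)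
        rw [h1] at h2
        have h3 : ‖q x‖ ≤ 2 * N * x := by nlinarith
        rw [hnG, Complex.ofReal_re, Real.rpow_one, ← neg_mul, ← mul_assoc]
        gcongr
      · intro x
        rw [hnG, hqb]
        simp
    rw [hnG, Real.exp_neg, ← div_eq_mul_inv, div_le_one (Real.exp_pos _)] at key
    exact key
  have hq1 : ‖q (s - c)‖ ≤ 1 := by
    have hz : 0 ≤ (s - c).re := by simpa using hs
    have hlim : Tendsto (fun ε : ℝ => Real.exp (ε * (s - c).re)) (𝓝[>] 0) (𝓝 1) := by
      have : Continuous fun ε : ℝ => Real.exp (ε * (s - c).re) := by fun_prop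
      simpa using (this.tendsto 0).mono_left nhdsWithin_le_nhds
    refine ge_of_tendsto hlim ?_
    filter_upwards [self_mem_nhdsWithin] with ε hε0
    exact hε ε hε0 _ hz
  rw [hq] at hq1
  simp only [norm_div, add_sub_cancel] at hq1
  rwa [div_le_one (hξ s hs)] at hq1

/-! ### Monotonicity -/

/-- If `riemannXi` had no zeros, the comparison with `c = -1/2` would give
`‖riemannXi (s + 2)‖ ≤ ‖riemannXi s‖`, which fails at large real `s`. -/
theorem exists_riemannXi_eq_zero : ∃ s, riemannXi s = 0 := by
  by_contra! h
  have h100 := norm_riemannXi_sub_le (σ₀ := -1) (c := -1 / 2) (K := 2) (M := 48)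
    (fun s _ => h s) (by norm_num) (fun s hs => ?_) (s := (100 : ℝ)) (by norm_num)
  · have h1 := norm_riemannXi_lt_add_two (x := 100) le_rfl
    rw [show ((100 : ℝ) : ℂ) - ((2 * (-1 / 2) - 1 : ℝ) : ℂ) = (100 : ℝ) + 2 by
      push_cast; ring] at h100
    linarith
  · rw [show s - ((2 * (-1 / 2) - 1 : ℝ) : ℂ) = s + 2 by push_cast; ring,
      show s - ((-1 / 2 : ℝ) : ℂ) + 1 = s + (3 / 2 : ℝ) by push_cast; ring]
    refine (norm_riemannXi_add_two_le hs).trans ?_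
    have : ‖s‖ ≤ ‖s + (3 / 2 : ℝ)‖ := by
      have := norm_sub_ofReal_le (d := 3 / 2) (by norm_num) (s := s + (3 / 2 : ℝ))
        (by simp; linarith)
      rwa [add_sub_cancel_right] at this
    gcongr

/-- A zero-free right half-plane lies to the right of the critical line, by the functional
equation and the existence of zeros. -/
theorem one_half_le_of_riemannXi_ne_zero {σ₀ : ℝ}
    (h0 : ∀ s : ℂ, σ₀ < s.re → riemannXi s ≠ 0) : 1 / 2 ≤ σ₀ := by
  by_contra! h
  obtain ⟨s, hs⟩ := exists_riemannXi_eq_zero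
  rcases lt_or_ge σ₀ s.re with h1 | h1
  · exact h0 s h1 hs
  · refine h0 (1 - s) ?_ (by rw [riemannXi_one_sub, hs])
    simp
    linarith

theorem norm_riemannXi_sub_le_of_ne_zero {σ₀ c : ℝ}
    (h0 : ∀ s : ℂ, σ₀ < s.re → riemannXi s ≠ 0) (hc : σ₀ < c) {s : ℂ} (hs : c ≤ s.re) :
    ‖riemannXi (s - (2 * c - 1 : ℝ))‖ ≤ ‖riemannXi s‖ := by
  have hσ := one_half_le_of_riemannXi_ne_zero h0
  obtain ⟨M, hM0, hM⟩ := exists_norm_riemannXi_sub_le_mul (d := 2 * c - 1) (by linarith)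
  refine norm_riemannXi_sub_le (K := 2 * c - 1 + 2) (M := M) h0 hc (fun z hz => ?_) hs
  refine (hM z hz).trans ?_
  have h1 : 1 ≤ ‖z - c + 1‖ := by
    have := Complex.re_le_norm (z - c + 1)
    simp at this
    linarith
  gcongr
  exact le_mul_of_one_le_right hM0 h1

/-- The midpoint `c = (a + b) / 2` makes the reflection carry `b + it` to `a + it`. -/
theorem norm_riemannXi_reflect (a b t : ℝ) :
    ‖riemannXi ((b : ℂ) + t * Complex.I - (2 * ((a + b) / 2) - 1 : ℝ))‖ =
      ‖riemannXi ((a : ℂ) + t * Complex.I)‖ := by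
  rw [norm_riemannXi_sub]
  congr 2
  simp
  ring

theorem norm_riemannXi_le_of_ne_zero {σ₀ a b : ℝ} (h0 : ∀ s : ℂ, σ₀ < s.re → riemannXi s ≠ 0)
    (ha : σ₀ < a) (hab : a ≤ b) (t : ℝ) :
    ‖riemannXi ((a : ℂ) + t * Complex.I)‖ ≤ ‖riemannXi ((b : ℂ) + t * Complex.I)‖ := by
  rw [← norm_riemannXi_reflect a b t]
  exact norm_riemannXi_sub_le_of_ne_zero h0 (by linarith) (by simp; linarith)

/-- Equality at one point would, by the maximum principle, give
`‖riemannXi (x - d)‖ = ‖riemannXi x‖` for all large real `x`, with the fixed period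
`d = a + b - 1 > 0`; together with monotonicity this contradicts the growth of `riemannXi` on the
real axis. -/
theorem norm_riemannXi_lt_of_ne_zero {σ₀ a b : ℝ} (h0 : ∀ s : ℂ, σ₀ < s.re → riemannXi s ≠ 0)
    (ha : σ₀ < a) (hab : a < b) (t : ℝ) :
    ‖riemannXi ((a : ℂ) + t * Complex.I)‖ < ‖riemannXi ((b : ℂ) + t * Complex.I)‖ := by
  refine lt_of_le_of_ne (norm_riemannXi_le_of_ne_zero h0 ha hab.le t) fun heq => ?_
  have hσ := one_half_le_of_riemannXi_ne_zero h0
  set c : ℝ := (a + b) / 2 with hc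
  have hσc : σ₀ < c := by linarith
  set d : ℝ := 2 * c - 1 with hd
  have hd0 : 0 < d := by linarith
  set U : Set ℂ := {s | c < s.re} with hU
  set q : ℂ → ℂ := fun z => riemannXi (z - d) / riemannXi z with hq
  have hξ : ∀ s ∈ U, riemannXi s ≠ 0 := fun s hs => h0 s (hσc.trans hs)
  have hqle : ∀ s ∈ U, ‖q s‖ ≤ 1 := fun s hs => by
    rw [hq]
    simp only [norm_div]
    rw [div_le_one (norm_pos_iff.mpr (hξ s hs))]
    exact norm_riemannXi_sub_le_of_ne_zero h0 hσc (le_of_lt hs)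
  set s₀ : ℂ := (b : ℂ) + t * Complex.I with hs₀
  have hs₀U : s₀ ∈ U := by
    simp [hU, hs₀]
    linarith
  have hqs₀ : ‖q s₀‖ = 1 := by
    rw [← norm_riemannXi_reflect a b t] at heq
    rw [hq]
    simp only [norm_div]
    rw [div_eq_one_iff_eq (norm_ne_zero_iff.mpr (hξ s₀ hs₀U))]
    exact heq
  have hUo : IsOpen U := isOpen_lt continuous_const Complex.continuous_re
  have hUc : IsPreconnected U := (convex_halfSpace_re_gt c).isPreconnected
  have hqd : DifferentiableOn ℂ q U := fun z hz =>
    (DifferentiableAt.div ((differentiable_riemannXi _).comp z (differentiableAt_id.sub_const _))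
      (differentiable_riemannXi z) (hξ z hz)).differentiableWithinAt
  have hconst := Complex.norm_eqOn_of_isPreconnected_of_isMaxOn hUc hUo hqd hs₀U
    (fun z hz => by simpa [hqs₀] using hqle z hz)
  have hper : ∀ x : ℝ, c < x → ‖riemannXi ((x : ℂ) - d)‖ = ‖riemannXi x‖ := fun x hx => by
    have hxU : (x : ℂ) ∈ U := by simpa [hU] using hx
    have h := hconst hxU
    simp only [Function.comp_apply, Function.const_apply, hqs₀] at h
    rw [hq] at h
    simp only [norm_div] at h
    rwa [div_eq_one_iff_eq (norm_ne_zero_iff.mpr (hξ x hxU))] at h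
  set x : ℝ := max 100 (c + 1) with hx
  have hxc : c < x := (by linarith : c < c + 1).trans_le (le_max_right _ _)
  have hiter : ∀ n : ℕ, ‖riemannXi ((x + n * d : ℝ) : ℂ)‖ = ‖riemannXi x‖ := fun n => by
    induction n with
    | zero => simp
    | succ n ih =>
      rw [← ih, ← hper (x + (n + 1 : ℕ) * d) (by
        have : 0 ≤ ((n + 1 : ℕ) : ℝ) * d := by positivity
        linarith)]
      congr 2
      push_cast
      ring
  obtain ⟨n, hn⟩ := exists_nat_gt (2 / d)
  rw [div_lt_iff₀ hd0] at hn
  have h1 := norm_riemannXi_lt_add_two (x := x) (le_max_left _ _)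
  have h2 := norm_riemannXi_le_of_ne_zero (a := x + 2) (b := x + n * d) h0 (by linarith)
    (by linarith) 0
  simp only [Complex.ofReal_zero, zero_mul, add_zero] at h2
  rw [hiter n] at h2
  push_cast at h2
  linarith

theorem theorem1 :
    (∀ σ₀ : ℝ, (∀ s : ℂ, σ₀ < s.re → riemannXi s ≠ 0) →
      ∀ σ₁ t₀ : ℝ, σ₀ ≤ σ₁ →
        StrictMonoOn (fun σ : ℝ => ‖riemannXi ((σ : ℂ) + (t₀ : ℂ) * Complex.I)‖) (Set.Ioi σ₁)) ∧
    (∀ σ₀ : ℝ, (∀ s : ℂ, s.re < σ₀ → riemannXi s ≠ 0) →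
      ∀ σ₁ t₀ : ℝ, σ₁ ≤ σ₀ →
        StrictAntiOn (fun σ : ℝ => ‖riemannXi ((σ : ℂ) + (t₀ : ℂ) * Complex.I)‖) (Set.Iio σ₁)) := by
  refine ⟨fun σ₀ h0 σ₁ t₀ hσ a ha b _ hab =>
    norm_riemannXi_lt_of_ne_zero h0 (hσ.trans_lt ha) hab t₀, fun σ₀ h0 σ₁ t₀ hσ a _ b hb hab => ?_⟩
  have hb' : b < σ₁ := hb
  have h0' : ∀ s : ℂ, 1 - σ₀ < s.re → riemannXi s ≠ 0 := fun s hs => by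
    rw [← riemannXi_one_sub]
    refine h0 _ ?_
    simp
    linarith
  have h := norm_riemannXi_lt_of_ne_zero h0' (by linarith : 1 - σ₀ < 1 - b)
    (by linarith : 1 - b < 1 - a) (-t₀)
  have hrefl : ∀ σ : ℝ, riemannXi (((1 - σ : ℝ) : ℂ) + ((-t₀ : ℝ) : ℂ) * Complex.I) =
      riemannXi ((σ : ℂ) + t₀ * Complex.I) := fun σ => by
    rw [← riemannXi_one_sub]
    congr 1
    push_cast
    ring
  rwa [hrefl, hrefl] at h
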